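/- Let $n\ge 2$, let $S^{n-1}$ be the unit sphere of $\mathbb R^n$, and let $\mathcal K_{(o)}^n$ be the set of compact convex sets $K\subset\mathbb R^n$ containing the origin in their interior, with the Hausdorff metric. For $K\in\mathcal K^n_{(o)}$ let $h_K(x)=\max_{y\in K}x\cdot y$, $\rho_K(x)=\max\{t\ge 0: tx\in K\}$ ($x\neq 0$), and $K^*=\{x: x\cdot y\le 1\ \forall y\in K\}$. For $\omega\subseteq S^{n-1}$ let $\boldsymbol\nu_K^{-1}(\omega)$ be the set of $x\in\partial K$ with $x\cdot u=h_K(u)$ for some $u\in\omega$; let $\boldsymbol\alpha_K^*(\omega)=\{\xi\in S^{n-1}:\rho_K(\xi)\xi\in\boldsymbol\nu_K^{-1}(\omega)\}$; and let $S(K,\omega)=\mathcal H^{n-1}(\boldsymbol\nu_K^{-1}(\omega))$ for Borel $\omega$ (the surface area measure). Let $\alpha_K(\xi)$ be the unit vector $u$ with $\rho_K(\xi)\,\xi\cdot u=h_K(u)$, wherever it is unique. Let $\mathcal C$ be the class of functions $G:S^{n-1}\times(0,\infty)\to\mathbb R$ for which $G$ and $G_t=\partial G/\partial t$ exist and are continuous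 on $S^{n-1}\times(0,\infty)$; let $\mathcal C_I$ (resp. $\mathcal C_d$) be the class of $G\in\mathcal C$ with $G_t>0$ (resp. $G_t<0$) everywhere; and let $\mathcal M$ be the class of nonzero finite Borel measures on $S^{n-1}$ that are absolutely continuous with respect to spherical Lebesgue measure. Let $\Theta=(G,\Psi,\lambda)$ with $G\in\mathcal C$, $\Psi\in\mathcal C_I\cup\mathcal C_d$ and $\lambda\in\mathcal M$. For each $K\in\mathcal K^n_{(o)}$, $\alpha_K$ is defined $\lambda$-almost everywhere, and the formulas $$\widetilde C_\Theta(K,\omega)=\int_{\boldsymbol\alpha^*_K(\omega)}\frac{\rho_K(\xi)\,G_t(\xi,\rho_K(\xi))}{h_K(\alpha_K(\xi))\,\Psi_t(\alpha_K(\xi),h_K(\alpha_K(\xi)))}\,d\lambda(\xi),$$ $$C_\Theta(K,\omega)=\int_{\boldsymbol\alpha^*_K(\omega)}\frac{\rho_K(\xi)\,G_t(\xi,\rho_K(\xi))}{\rho_{K^*}(\alpha_K(\xi))\,\Psi_t(\alpha_K(\xi),\rho_{K^*}(\alpha_K(\xi)))}\,d\lambda(\xi)$$ ($\omega\subseteq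 S^{n-1}$ Borel) define finite signed Borel measures on $S^{n-1}$ (the sets $\boldsymbol\alpha_K^*(\omega)$ are $\lambda$-measurable and the integrands are $\lambda$-integrable). Moreover: (i) If $K_i,K\in\mathcal K^n_{(o)}$ and $K_i\to K$ in the Hausdorff metric, then $C_\Theta(K_i,\cdot)\to C_\Theta(K,\cdot)$ and $\widetilde C_\Theta(K_i,\cdot)\to\widetilde C_\Theta(K,\cdot)$ weakly, i.e. the integrals of every continuous function on $S^{n-1}$ converge. (ii) For every $K\in\mathcal K^n_{(o)}$, $C_\Theta(K,\cdot)$ and $\widetilde C_\Theta(K,\cdot)$ are absolutely continuous with respect to $S(K,\cdot)$. (iii) If $G,\Psi$ are both in $\mathcal C_I$ or both in $\mathcal C_d$, then for every $K\in\mathcal K^n_{(o)}$ both $\widetilde C_\Theta(K,\cdot)$ and $C_\Theta(K,\cdot)$ are nonzero finite (nonnegative) Borel measures. If, in addition, $\lambda(U)>0$ for every nonempty open $U\subseteq S^{n-1}$, then neither of them is concentrated on a closed hemisphere, where $\mu$ is said to be not concentrated on any closed hemisphere if $\int_{S^{n-1}}\max\{u\cdot\xi,0\}\,d\mu(\xi)>0$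 for every $u\in S^{n-1}$. If one of $G,\Psi$ is in $\mathcal C_I$ and the other in $\mathcal C_d$, the same assertions hold for $-\widetilde C_\Theta(K,\cdot)$ and $-C_\Theta(K,\cdot)$. -/

import Mathlib

open MeasureTheory Set Filter Topology

namespace MusielakOrliczGauss

/-- The Euclidean space `ℝⁿ`. -/
abbrev E (n : ℕ) := EuclideanSpace ℝ (Fin n)

/-- The unit sphere `Sⁿ⁻¹` of `ℝⁿ`. -/
abbrev Sph (n : ℕ) := Metric.sphere (0 : E n) 1

/-- The convex bodies of `ℝⁿ` with the origin in their interior. As a subtype of `ConvexBody`, it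
carries the Hausdorff metric. -/
abbrev Body (n : ℕ) := {K : ConvexBody (E n) // (0 : E n) ∈ interior (K : Set (E n))}

/-- The underlying set of a convex body. -/
abbrev Body.set {n : ℕ} (K : Body n) : Set (E n) := (K.1 : Set (E n))

variable {n : ℕ}

/-! ### Support function, radial function, polar body -/

/-- The support function `h_A(x) = sup {x · y : y ∈ A}`. -/
noncomputable def supportFn (A : Set (E n)) (x : E n) : ℝ :=
  sSup {r : ℝ | ∃ y ∈ A, r = inner ℝ x y}

/-- The radial function `ρ_A(x) = sup {t ≥ 0 : t x ∈ A}`. -/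
noncomputable def radialFn (A : Set (E n)) (x : E n) : ℝ :=
  sSup {t : ℝ | 0 ≤ t ∧ t • x ∈ A}

/-- The polar set `A* = {x : x · y ≤ 1 for all y ∈ A}`. -/
def polarSet (A : Set (E n)) : Set (E n) :=
  {x | ∀ y ∈ A, inner ℝ x y ≤ 1}

/-! ### Gauss map, radial Gauss image and its reverse -/

/-- The (multivalued) Gauss map: the unit vectors `u` with `x · u = h_A(u)`. -/
def gaussMap (A : Set (E n)) (x : E n) : Set (Sph n) :=
  {u | inner ℝ x (u : E n) = supportFn A u}

/-- The reverse Gauss image of `ω`: the boundary points with an outer unit normal in `ω`. -/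
def reverseGaussImage (A : Set (E n)) (ω : Set (Sph n)) : Set (E n) :=
  {x | x ∈ frontier A ∧ ∃ u ∈ ω, inner ℝ x (u : E n) = supportFn A u}

/-- The radial map `r_A(ξ) = ρ_A(ξ) ξ`. -/
noncomputable def radialMap (A : Set (E n)) (ξ : Sph n) : E n :=
  radialFn A ξ • (ξ : E n)

/-- The (multivalued) radial Gauss image of a point of the sphere. -/
noncomputable def radialGaussImage (A : Set (E n)) (ξ : Sph n) : Set (Sph n) :=
  gaussMap A (radialMap A ξ)

/-- The radial Gauss map: the unique element of the radial Gauss image where there is just one;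
an irrelevant value is used on the remaining exceptional set. -/
noncomputable def radialGaussMap (A : Set (E n)) (ξ : Sph n) : Sph n :=
  open Classical in
  if h : ∃ v : Sph n, radialGaussImage A ξ = {v} then h.choose else ξ

/-- The reverse radial Gauss image of `ω`: the inverse image under the radial map of the reverse
Gauss image of `ω`. -/
noncomputable def reverseRadialGaussImage (A : Set (E n)) (ω : Set (Sph n)) : Set (Sph n) :=
  radialMap A ⁻¹' reverseGaussImage A ω

/-- The surface area measure `S(K, ω)`, the `(n-1)`-dimensional Hausdorff measure of the reverse
Gauss image of a Borel set `ω`. -/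
noncomputable def surfaceArea (K : Body n) (ω : Set (Sph n)) : ENNReal :=
  Measure.euclideanHausdorffMeasure (n - 1) (reverseGaussImage K.set ω)

/-! ### The function classes and the class of measures -/

/-- The partial derivative `G_t(ξ, t)`. -/
noncomputable def partialT (G : Sph n → ℝ → ℝ) (ξ : Sph n) (t : ℝ) : ℝ := deriv (G ξ) t

/-- The class `𝒞`: on `Sⁿ⁻¹ × (0, ∞)`, `G` is continuous, `G_t` exists and is continuous. Values of
`G` at `t ≤ 0` play no role. -/
structure ClassC (G : Sph n → ℝ → ℝ) : Prop where
  continuousOn : ContinuousOn (fun p : Sph n × ℝ => G p.1 p.2) (univ ×ˢ Ioi 0)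
  differentiableAt : ∀ ξ : Sph n, ∀ t : ℝ, 0 < t → DifferentiableAt ℝ (G ξ) t
  continuousOn_partialT :
    ContinuousOn (fun p : Sph n × ℝ => partialT G p.1 p.2) (univ ×ˢ Ioi 0)

/-- The class `𝒞_I`: `G ∈ 𝒞` with `G_t > 0`. -/
structure ClassCI (G : Sph n → ℝ → ℝ) : Prop extends ClassC G where
  pos : ∀ ξ : Sph n, ∀ t : ℝ, 0 < t → 0 < partialT G ξ t

/-- The class `𝒞_d`: `G ∈ 𝒞` with `G_t < 0`. -/
structure ClassCd (G : Sph n → ℝ → ℝ) : Prop extends ClassC G where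
  neg : ∀ ξ : Sph n, ∀ t : ℝ, 0 < t → partialT G ξ t < 0

/-- The class `ℳ`: nonzero finite Borel measures on the sphere that are absolutely continuous with
respect to the spherical Lebesgue measure. -/
structure ClassM (lam : Measure (Sph n)) : Prop where
  finite : IsFiniteMeasure lam
  ne_zero : lam ≠ 0
  absolutelyContinuous : lam ≪ (volume : Measure (E n)).toSphere

/-! ### The Musielak-Orlicz-Gauss image measure and its polar version -/

/-- The integrand in the definition of `C̃_Θ(K, ·)`. -/
noncomputable def density (G Ψ : Sph n → ℝ → ℝ) (K : Body n) (ξ : Sph n) : ℝ :=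
  let α := radialGaussMap K.set ξ
  (radialFn K.set ξ * partialT G ξ (radialFn K.set ξ)) /
    (supportFn K.set α * partialT Ψ α (supportFn K.set α))

/-- The integrand in the definition of `C_Θ(K, ·)`. -/
noncomputable def polarDensity (G Ψ : Sph n → ℝ → ℝ) (K : Body n) (ξ : Sph n) : ℝ :=
  let α := radialGaussMap K.set ξ
  (radialFn K.set ξ * partialT G ξ (radialFn K.set ξ)) /
    (radialFn (polarSet K.set) α * partialT Ψ α (radialFn (polarSet K.set) α))

/-- The signed Borel measure `μ` is given by `μ(ω) = ∫ f dλ` over the reverse radial Gauss image of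
`ω`, for every Borel set `ω`, where all these integrals make sense. -/
structure IsImageMeasure (lam : Measure (Sph n)) (K : Body n) (f : Sph n → ℝ)
    (μ : SignedMeasure (Sph n)) : Prop where
  integrable : Integrable f lam
  nullMeasurableSet : ∀ ω : Set (Sph n), MeasurableSet ω →
    NullMeasurableSet (reverseRadialGaussImage K.set ω) lam
  apply_eq : ∀ ω : Set (Sph n), MeasurableSet ω →
    μ ω = ∫ ξ in reverseRadialGaussImage K.set ω, f ξ ∂lam

/-- The signed Borel measure `ω ↦ ∫ f dλ` over the reverse radial Gauss image of `ω`. It is unique;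
the value `0` is only a convention for the case that there is none. -/
noncomputable def imageMeasure (lam : Measure (Sph n)) (K : Body n) (f : Sph n → ℝ) :
    SignedMeasure (Sph n) :=
  open Classical in
  if h : ∃ μ : SignedMeasure (Sph n), IsImageMeasure lam K f μ then h.choose else 0

/-- The Musielak-Orlicz-Gauss image measure `C̃_Θ(K, ·)` of `Θ = (G, Ψ, λ)`. -/
noncomputable def mogMeasure (G Ψ : Sph n → ℝ → ℝ) (lam : Measure (Sph n)) (K : Body n) :
    SignedMeasure (Sph n) :=
  imageMeasure lam K (density G Ψ K)

/-- The polar Musielak-Orlicz-Gauss image measure `C_Θ(K, ·)` of `Θ = (G, Ψ, λ)`. -/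
noncomputable def polarMogMeasure (G Ψ : Sph n → ℝ → ℝ) (lam : Measure (Sph n)) (K : Body n) :
    SignedMeasure (Sph n) :=
  imageMeasure lam K (polarDensity G Ψ K)

/-! ### Properties of signed measures on the sphere -/

/-- Weak convergence: the integrals of all continuous functions converge. -/
def WeaklyConverges (μ : ℕ → SignedMeasure (Sph n)) (ν : SignedMeasure (Sph n)) : Prop :=
  ∀ f : C(Sph n, ℝ), Tendsto (fun i => ∫ᵛ u, f u ∂•(μ i)) atTop (𝓝 (∫ᵛ u, f u ∂•ν))

/-- Absolute continuity with respect to the surface area measure of `K`. -/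
def AbsContSurfaceArea (μ : SignedMeasure (Sph n)) (K : Body n) : Prop :=
  ∀ ω : Set (Sph n), MeasurableSet ω → surfaceArea K ω = 0 → μ ω = 0

/-- The signed measure `μ` is a nonzero finite (nonnegative) Borel measure. -/
def IsNonzeroFiniteMeasure (μ : SignedMeasure (Sph n)) : Prop :=
  ∃ m : Measure (Sph n), ∃ _ : IsFiniteMeasure m, m ≠ 0 ∧ μ = m.toSignedMeasure

/-- Not concentrated on any closed hemisphere: `∫ (u · ξ)₊ dμ(ξ) > 0` for all unit vectors `u`. -/
def NotConcentratedOnHemisphere (μ : SignedMeasure (Sph n)) : Prop :=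
  ∀ u : Sph n, 0 < ∫ᵛ ξ, max (inner ℝ (u : E n) (ξ : E n)) 0 ∂•μ

end MusielakOrliczGauss

namespace MusielakOrliczGauss

variable {n : ℕ}

/-! ### Support and radial functions of convex bodies -/

/-! Both measures are push-forwards under the radial Gauss map `α_K` of `q(K, ξ, α_K(ξ)) dλ(ξ)`,
where the kernel `q` is jointly continuous in the body, the direction and the normal; the two
kernels differ only in using `h_K` or `ρ_{K*} = 1 / h_K`.

The gauge of `K` is Lipschitz, hence differentiable almost everywhere, and wherever it is
differentiable its gradient determines the unit normal (`toSphere_ae_exists_singleton`). Pairs of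
directions and normals form a closed relation, also when the body varies, so `α_K` is continuous on
the set of unique normals and `α_{K_i} → α_K` almost everywhere (`tendsto_of_mem_radialGaussImage`).
Dominated convergence then gives (i).

For (ii), radial projection is Lipschitz away from the origin, so an `ℋ^{n-1}`-null part of the
boundary projects to an `ℋ^{n-1}`-null set on the sphere; such a set has spherical measure zero
because the cone over it is Lebesgue null (`toSphere_eq_zero_of_hausdorffMeasure_eq_zero`).

For (iii), the kernel has constant sign, and normals at directions near `u` have positive inner
product with `u` (`exists_inner_radialGaussImage_pos`). -/

theorem Body.mem_nhds_zero (K : Body n) : K.set ∈ 𝓝 (0 : E n) := mem_interior_iff_mem_nhds.1 K.2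

theorem Body.absorbent (K : Body n) : Absorbent ℝ K.set := absorbent_nhds_zero K.mem_nhds_zero

theorem Body.gauge_pos (K : Body n) {x : E n} (hx : x ≠ 0) : 0 < gauge K.set x :=
  (_root_.gauge_pos K.absorbent (NormedSpace.isVonNBounded_of_isBounded ℝ K.1.isBounded)).2 hx

theorem Body.mem_iff_gauge_le_one (K : Body n) {x : E n} : x ∈ K.set ↔ gauge K.set x ≤ 1 := by
  rw [gauge_le_one_iff_mem_closure K.1.convex K.mem_nhds_zero, K.1.isClosed.closure_eq]

theorem sphere_ne_zero (ξ : Sph n) : (ξ : E n) ≠ 0 := ne_zero_of_mem_unit_sphere ξ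

theorem norm_sphere (ξ : Sph n) : ‖(ξ : E n)‖ = 1 := norm_eq_of_mem_sphere ξ

theorem Body.bddAbove_inner (K : Body n) (x : E n) :
    BddAbove {r : ℝ | ∃ y ∈ K.set, r = inner ℝ x y} := by
  have := (K.1.isCompact.image (f := fun y : E n => inner ℝ x y) (by fun_prop)).bddAbove
  refine this.mono ?_
  rintro _ ⟨y, hy, rfl⟩
  exact ⟨y, hy, rfl⟩

theorem inner_le_supportFn (K : Body n) (x : E n) {y : E n} (hy : y ∈ K.set) :
    inner ℝ x y ≤ supportFn K.set x := le_csSup (K.bddAbove_inner x) ⟨y, hy, rfl⟩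

theorem supportFn_le (K : Body n) {x : E n} {c : ℝ} (h : ∀ y ∈ K.set, inner ℝ x y ≤ c) :
    supportFn K.set x ≤ c := by
  obtain ⟨y, hy⟩ := K.1.nonempty
  refine csSup_le ⟨_, y, hy, rfl⟩ ?_
  rintro _ ⟨z, hz, rfl⟩
  exact h z hz

theorem supportFn_pos (K : Body n) (v : Sph n) : 0 < supportFn K.set v := by
  have hg := K.gauge_pos (sphere_ne_zero v)
  have hm : (gauge K.set v)⁻¹ • (v : E n) ∈ K.set := by
    rw [K.mem_iff_gauge_le_one, gauge_smul_of_nonneg (by positivity), smul_eq_mul,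
      inv_mul_cancel₀ hg.ne']
  refine lt_of_lt_of_le ?_ (inner_le_supportFn K v hm)
  rw [inner_smul_right, real_inner_self_eq_norm_sq, norm_sphere]
  positivity

theorem supportFn_le_add_dist (K L : Body n) (x : E n) :
    supportFn K.set x ≤ supportFn L.set x + dist K L * ‖x‖ := by
  refine supportFn_le K fun y hy => ?_
  obtain ⟨z, hz, hyz⟩ := L.1.isCompact.exists_infDist_eq_dist L.1.nonempty y
  have h1 : dist y z ≤ dist K L := by
    rw [← hyz, Subtype.dist_eq, ← ConvexBody.hausdorffDist_coe]
    exact Metric.infDist_le_hausdorffDist_of_mem hy ConvexBody.hausdorffEDist_ne_top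
  have h2 : inner ℝ x y = inner ℝ x z + inner ℝ x (y - z) := by
    rw [← inner_add_right]; congr 1; abel
  rw [h2]
  refine add_le_add (inner_le_supportFn L x hz) ((real_inner_le_norm _ _).trans ?_)
  rw [mul_comm, ← dist_eq_norm]
  gcongr

theorem supportFn_le_add_norm_sub (K : Body n) {R : ℝ} (hR : ∀ y ∈ K.set, ‖y‖ ≤ R) (x x' : E n) :
    supportFn K.set x ≤ supportFn K.set x' + R * ‖x - x'‖ := by
  refine supportFn_le K fun y hy => ?_
  have h2 : inner ℝ x y = inner ℝ x' y + inner ℝ (x - x') y := by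
    rw [← inner_add_left]; congr 1; abel
  rw [h2]
  refine add_le_add (inner_le_supportFn K x' hy) ((real_inner_le_norm _ _).trans ?_)
  rw [mul_comm]
  gcongr
  exact hR y hy

theorem continuous_supportFn_set (K : Body n) : Continuous (supportFn K.set) := by
  obtain ⟨R, hR0, hR⟩ := K.1.isBounded.exists_pos_norm_le
  refine (LipschitzWith.of_le_add_mul ⟨R, hR0.le⟩ fun x y => ?_).continuous
  rw [dist_eq_norm]
  exact supportFn_le_add_norm_sub K hR x y

/-- The support function depends continuously on the body and the direction. -/
theorem continuous_supportFn :
    Continuous fun p : Body n × Sph n => supportFn p.1.set p.2 := by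
  rw [continuous_iff_continuousAt]
  rintro ⟨K, v⟩
  have h1 : Tendsto (fun p : Body n × Sph n => supportFn K.set p.2) (𝓝 (K, v))
      (𝓝 (supportFn K.set v)) :=
    ((continuous_supportFn_set K).comp (continuous_subtype_val.comp continuous_snd)).tendsto (K, v)
  refine h1.congr_dist ?_
  have h2 : Tendsto (fun p : Body n × Sph n => dist K p.1) (𝓝 (K, v)) (𝓝 0) := by
    have : Continuous fun p : Body n × Sph n => dist K p.1 := by fun_prop
    simpa using this.tendsto (K, v)
  refine squeeze_zero (fun _ => dist_nonneg) (fun p => ?_) h2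
  rw [Real.dist_eq, abs_le]
  have a := supportFn_le_add_dist K p.1 p.2
  have b := supportFn_le_add_dist p.1 K p.2
  rw [norm_sphere, mul_one] at a b
  rw [dist_comm] at b
  constructor <;> linarith

theorem sSup_nonneg_mul_le_one {c : ℝ} (hc : 0 < c) : sSup {t : ℝ | 0 ≤ t ∧ t * c ≤ 1} = c⁻¹ := by
  have : {t : ℝ | 0 ≤ t ∧ t * c ≤ 1} = Icc 0 c⁻¹ := by
    ext t
    simp only [mem_ofPred_eq, mem_Icc, ← le_div_iff₀ hc, one_div]
  rw [this, csSup_Icc (by positivity)]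

theorem radialFn_eq_inv_gauge (K : Body n) {x : E n} (hx : x ≠ 0) :
    radialFn K.set x = (gauge K.set x)⁻¹ := by
  rw [← sSup_nonneg_mul_le_one (K.gauge_pos hx), radialFn]
  congr 1
  ext t
  refine and_congr_right fun ht => ?_
  rw [K.mem_iff_gauge_le_one, gauge_smul_of_nonneg ht, smul_eq_mul]

/-- For `t ≥ 0`, the point `t v` lies in the polar body exactly when `t h_K(v) ≤ 1`. -/
theorem radialFn_polarSet (K : Body n) (v : Sph n) :
    radialFn (polarSet K.set) v = (supportFn K.set v)⁻¹ := by
  have hv := supportFn_pos K v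
  rw [← sSup_nonneg_mul_le_one hv, radialFn]
  congr 1
  ext t
  refine and_congr_right fun ht => ⟨fun h => ?_, fun h y hy => ?_⟩
  · rcases ht.eq_or_lt with rfl | ht
    · simp
    · rw [mul_comm, ← le_div_iff₀ ht]
      refine supportFn_le K fun y hy => ?_
      rw [le_div_iff₀ ht, mul_comm, ← real_inner_smul_left]
      exact h y hy
  · rw [real_inner_smul_left]
    exact (mul_le_mul_of_nonneg_left (inner_le_supportFn K v hy) ht).trans h

theorem radialFn_pos (K : Body n) (ξ : Sph n) : 0 < radialFn K.set ξ := by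
  rw [radialFn_eq_inv_gauge K (sphere_ne_zero ξ)]
  exact inv_pos.2 (K.gauge_pos (sphere_ne_zero ξ))

theorem continuous_radialFn_set (K : Body n) : Continuous fun ξ : Sph n => radialFn K.set ξ := by
  simp_rw [fun ξ : Sph n => radialFn_eq_inv_gauge K (sphere_ne_zero ξ)]
  exact ((continuous_gauge K.1.convex K.mem_nhds_zero).comp continuous_subtype_val).inv₀
    fun ξ => (K.gauge_pos (sphere_ne_zero ξ)).ne'

theorem gauge_radialMap (K : Body n) (ξ : Sph n) : gauge K.set (radialMap K.set ξ) = 1 := by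
  rw [radialMap, gauge_smul_of_nonneg (radialFn_pos K ξ).le, smul_eq_mul,
    radialFn_eq_inv_gauge K (sphere_ne_zero ξ),
    inv_mul_cancel₀ (K.gauge_pos (sphere_ne_zero ξ)).ne']

theorem radialMap_mem (K : Body n) (ξ : Sph n) : radialMap K.set ξ ∈ K.set :=
  K.mem_iff_gauge_le_one.2 (gauge_radialMap K ξ).le

theorem radialMap_mem_frontier (K : Body n) (ξ : Sph n) : radialMap K.set ξ ∈ frontier K.set :=
  (gauge_eq_one_iff_mem_frontier K.1.convex K.mem_nhds_zero).1 (gauge_radialMap K ξ)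

theorem mem_reverseRadialGaussImage (K : Body n) (ω : Set (Sph n)) (ξ : Sph n) :
    ξ ∈ reverseRadialGaussImage K.set ω ↔ ∃ v ∈ ω, v ∈ radialGaussImage K.set ξ :=
  ⟨fun h => h.2, fun h => ⟨radialMap_mem_frontier K ξ, h⟩⟩

theorem mem_radialGaussImage {K : Body n} {ξ v : Sph n} :
    v ∈ radialGaussImage K.set ξ ↔
      radialFn K.set ξ * inner ℝ (ξ : E n) (v : E n) = supportFn K.set v := by
  rw [radialGaussImage, gaussMap, mem_ofPred_eq, radialMap, real_inner_smul_left]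

theorem radialFn_mul_inner_le (K : Body n) (ξ v : Sph n) :
    radialFn K.set ξ * inner ℝ (ξ : E n) (v : E n) ≤ supportFn K.set v := by
  rw [← real_inner_smul_left, real_inner_comm]
  exact inner_le_supportFn K v (radialMap_mem K ξ)

/-- Every boundary point has an outer unit normal. -/
theorem radialGaussImage_nonempty (K : Body n) (ξ : Sph n) :
    (radialGaussImage K.set ξ).Nonempty := by
  have hx := (radialMap_mem_frontier K ξ).2
  set x := radialMap K.set ξ with hxdef
  obtain ⟨f, hf⟩ := geometric_hahn_banach_open_point K.1.convex.interior isOpen_interior hx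
  obtain ⟨w, rfl⟩ := (InnerProductSpace.toDual ℝ (E n)).surjective f
  simp only [InnerProductSpace.toDual_apply_apply] at hf
  -- The separation is strict on the interior only; it passes to `K` because `K` lies in the closure
  -- of its interior.
  have hle : ∀ y ∈ K.set, inner ℝ w y ≤ inner ℝ w x := by
    intro y hy
    have hy' : y ∈ closure (interior K.set) := by
      rw [K.1.convex.closure_interior_eq_closure_of_nonempty_interior ⟨0, K.2⟩]
      exact subset_closure hy
    exact closure_minimal (t := {y | inner ℝ w y ≤ inner ℝ w x}) (fun z hz => (hf z hz).le)
      (isClosed_le (by fun_prop) (by fun_prop)) hy'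
  have hw : w ≠ 0 := by
    rintro rfl
    simpa using hf 0 K.2
  have hwn : 0 < ‖w‖ := norm_pos_iff.2 hw
  refine ⟨⟨‖w‖⁻¹ • w, by simp [norm_smul, hwn.ne']⟩, le_antisymm ?_ ?_⟩
  · rw [real_inner_comm]
    exact inner_le_supportFn K _ (radialMap_mem K ξ)
  · refine supportFn_le K fun y hy => ?_
    rw [real_inner_comm (‖w‖⁻¹ • w), real_inner_smul_left, real_inner_smul_left]
    exact mul_le_mul_of_nonneg_left (hle y hy) (by positivity)

theorem inner_pos_of_mem_radialGaussImage {K : Body n} {ξ v : Sph n}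
    (h : v ∈ radialGaussImage K.set ξ) : 0 < inner ℝ (ξ : E n) (v : E n) := by
  rw [mem_radialGaussImage] at h
  have := supportFn_pos K v
  rw [← h] at this
  exact (pos_iff_pos_of_mul_pos this).1 (radialFn_pos K ξ)

/-- At a normal `v` of `L`, `h_L(v)` is attained by the boundary point in direction `ξ`, so `ρ_K /
ρ_L` at `ξ` is at most `h_K / h_L` at `v`. This turns closeness of support functions into closeness
of radial functions. -/
theorem radialFn_mul_supportFn_le {K L : Body n} {ξ v : Sph n}
    (h : v ∈ radialGaussImage L.set ξ) :
    radialFn K.set ξ * supportFn L.set v ≤ radialFn L.set ξ * supportFn K.set v := by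
  rw [← mem_radialGaussImage.1 h]
  calc _ = radialFn L.set ξ * (radialFn K.set ξ * inner ℝ (ξ : E n) (v : E n)) := by ring
    _ ≤ _ := by
      gcongr
      · exact (radialFn_pos L ξ).le
      · exact radialFn_mul_inner_le K ξ v

theorem radialFn_le_supportFn (K : Body n) (ξ : Sph n) :
    radialFn K.set ξ ≤ supportFn K.set ξ := by
  have := radialFn_mul_inner_le K ξ ξ
  rwa [real_inner_self_eq_norm_sq, norm_sphere, one_pow, mul_one] at this

theorem exists_supportFn_bounds [Nonempty (Sph n)] (K : Body n) :
    ∃ a b : ℝ, 0 < a ∧ ∀ v : Sph n, a ≤ supportFn K.set v ∧ supportFn K.set v ≤ b := by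
  have hc : Continuous fun v : Sph n => supportFn K.set v :=
    (continuous_supportFn_set K).comp continuous_subtype_val
  obtain ⟨v, -, hv⟩ := isCompact_univ.exists_isMinOn univ_nonempty hc.continuousOn
  obtain ⟨w, -, hw⟩ := isCompact_univ.exists_isMaxOn univ_nonempty hc.continuousOn
  exact ⟨_, _, supportFn_pos K v, fun u => ⟨hv (mem_univ u), hw (mem_univ u)⟩⟩

theorem radialFn_sub_le {K L : Body n} {a b d : ℝ} (ha : 0 < a)
    (hL : ∀ v : Sph n, a ≤ supportFn L.set v ∧ supportFn L.set v ≤ b)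
    (hd : ∀ v : Sph n, supportFn K.set v ≤ supportFn L.set v + d) (hd0 : 0 ≤ d) (ξ : Sph n) :
    radialFn K.set ξ ≤ radialFn L.set ξ + b / a * d := by
  obtain ⟨v, hv⟩ := radialGaussImage_nonempty L ξ
  have h1 := radialFn_mul_supportFn_le (K := K) hv
  have hLv := supportFn_pos L v
  have hρ := radialFn_pos L ξ
  have hb : radialFn L.set ξ ≤ b := (radialFn_le_supportFn L ξ).trans (hL ξ).2
  have h2 : radialFn K.set ξ ≤ radialFn L.set ξ * (supportFn L.set v + d) / supportFn L.set v := by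
    rw [le_div_iff₀ hLv]
    exact h1.trans (by gcongr; exact hd v)
  refine h2.trans ?_
  rw [mul_add, add_div, mul_div_cancel_right₀ _ hLv.ne', mul_div_right_comm]
  gcongr
  exact hρ.le.trans hb
  exact (hL v).1

/-- The radial function depends continuously on the body and the direction. -/
theorem continuous_radialFn :
    Continuous fun p : Body n × Sph n => radialFn p.1.set p.2 := by
  rcases isEmpty_or_nonempty (Sph n) with h | h
  · exact continuous_of_const fun p => h.elim p.2
  rw [continuous_iff_continuousAt]
  rintro ⟨K, ξ⟩
  have h1 : Tendsto (fun p : Body n × Sph n => radialFn K.set p.2) (𝓝 (K, ξ))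
      (𝓝 (radialFn K.set ξ)) :=
    ((continuous_radialFn_set K).comp continuous_snd).tendsto (K, ξ)
  refine h1.congr_dist ?_
  obtain ⟨a, b, ha, hab⟩ := exists_supportFn_bounds K
  have hd : Tendsto (fun p : Body n × Sph n => dist K p.1) (𝓝 (K, ξ)) (𝓝 0) := by
    have : Continuous fun p : Body n × Sph n => dist K p.1 := by fun_prop
    simpa using this.tendsto (K, ξ)
  have h2 : Tendsto (fun p : Body n × Sph n => (b + a / 2) / (a / 2) * dist K p.1) (𝓝 (K, ξ))
      (𝓝 0) := by
    simpa using hd.const_mul ((b + a / 2) / (a / 2))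
  refine squeeze_zero' (Eventually.of_forall fun _ => dist_nonneg) ?_ h2
  filter_upwards [hd.eventually_le_const (half_pos ha)] with p hp
  have e1 : ∀ v : Sph n, supportFn K.set v ≤ supportFn p.1.set v + dist K p.1 := fun v => by
    simpa only [norm_sphere, mul_one] using supportFn_le_add_dist K p.1 v
  have e2 : ∀ v : Sph n, supportFn p.1.set v ≤ supportFn K.set v + dist K p.1 := fun v => by
    simpa only [norm_sphere, mul_one, dist_comm] using supportFn_le_add_dist p.1 K v
  rw [Real.dist_eq, abs_le]
  -- Within distance `a / 2` of `K`, both support functions have values in `[a / 2, b + a / 2]`, so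
  -- one constant serves both directions of the comparison.
  have f1 := radialFn_sub_le (a := a / 2) (b := b + a / 2) (by positivity)
    (fun v => ⟨by linarith [(hab v).1, e1 v], by linarith [(hab v).2, e2 v]⟩) e1 dist_nonneg p.2
  have f2 := radialFn_sub_le (a := a / 2) (b := b + a / 2) (by positivity)
    (fun v => ⟨by linarith [(hab v).1], by linarith [(hab v).2]⟩) e2 dist_nonneg p.2
  constructor <;> linarith

/-! ### The radial Gauss map -/

theorem radialGaussImage_eq_singleton {A : Set (E n)} {ξ : Sph n}
    (h : ∃ v : Sph n, radialGaussImage A ξ = {v}) :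
    radialGaussImage A ξ = {radialGaussMap A ξ} := by
  rw [radialGaussMap, dif_pos h]
  exact h.choose_spec

/-- Unit normals have closed graph, so they converge wherever the limit normal is unique. -/
theorem tendsto_of_mem_radialGaussImage {ι : Type*} {l : Filter ι} {Ks : ι → Body n} {K : Body n}
    {ξs vs : ι → Sph n} {ξ v : Sph n} (hK : Tendsto Ks l (𝓝 K)) (hξ : Tendsto ξs l (𝓝 ξ))
    (hv : ∀ᶠ i in l, vs i ∈ radialGaussImage (Ks i).set (ξs i))
    (h : radialGaussImage K.set ξ = {v}) : Tendsto vs l (𝓝 v) := by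
  -- By compactness of the sphere, it suffices that every cluster point is a normal of `K` at `ξ`;
  -- this follows by passing to the limit in `ρ ξ · v = h(v)` along an ultrafilter.
  refine isCompact_univ.tendsto_nhds_of_unique_mapClusterPt (Eventually.of_forall fun _ => mem_univ _)
    fun w _ hw => ?_
  obtain ⟨U, hU, hw⟩ := mapClusterPt_iff_ultrafilter.1 hw
  have hK' := hK.mono_left hU
  have hξ' := hξ.mono_left hU
  have t1 : Tendsto (fun i => radialFn (Ks i).set (ξs i) * inner ℝ (ξs i : E n) (vs i : E n)) U
      (𝓝 (radialFn K.set ξ * inner ℝ (ξ : E n) (w : E n))) :=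
    ((continuous_radialFn.tendsto (K, ξ)).comp (hK'.prodMk_nhds hξ')).mul
      (((continuous_subtype_val.tendsto ξ).comp hξ').inner
        ((continuous_subtype_val.tendsto w).comp hw))
  have t2 : Tendsto (fun i => supportFn (Ks i).set (vs i)) U (𝓝 (supportFn K.set w)) :=
    (continuous_supportFn.tendsto (K, w)).comp (hK'.prodMk_nhds hw)
  have : w ∈ radialGaussImage K.set ξ := by
    rw [mem_radialGaussImage]
    refine tendsto_nhds_unique_of_eventuallyEq t1 t2 ?_
    filter_upwards [hv.filter_mono hU] with i hi
    exact mem_radialGaussImage.1 hi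
  rwa [h] at this

/-! ### Almost everywhere uniqueness of the normal -/

theorem inner_le_gauge_mul_supportFn (K : Body n) (w y : E n) :
    inner ℝ w y ≤ gauge K.set y * supportFn K.set w := by
  rcases eq_or_ne y 0 with rfl | hy
  · simp
  have hg := K.gauge_pos hy
  have hm : (gauge K.set y)⁻¹ • y ∈ K.set := by
    rw [K.mem_iff_gauge_le_one, gauge_smul_of_nonneg (by positivity), smul_eq_mul,
      inv_mul_cancel₀ hg.ne']
  have := inner_le_supportFn K w hm
  rwa [inner_smul_right, inv_mul_le_iff₀ hg] at this

/-- The gauge minus the linear function `y ↦ w · y / h_K(w)` is nonnegative and vanishes at `ξ`, so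
it has a minimum there and its derivative is zero. -/
theorem fderiv_gauge_of_mem_radialGaussImage {K : Body n} {ξ w : Sph n}
    (hd : DifferentiableAt ℝ (gauge K.set) ξ) (hw : w ∈ radialGaussImage K.set ξ) :
    fderiv ℝ (gauge K.set) ξ = (supportFn K.set w)⁻¹ • innerSL ℝ (w : E n) := by
  have hh := supportFn_pos K w
  have hD : HasFDerivAt (fun y => gauge K.set y - ((supportFn K.set w)⁻¹ • innerSL ℝ (w : E n)) y)
      (fderiv ℝ (gauge K.set) ξ - (supportFn K.set w)⁻¹ • innerSL ℝ (w : E n)) (ξ : E n) :=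
    hd.hasFDerivAt.sub (ContinuousLinearMap.hasFDerivAt _)
  have hmin : IsLocalMin
      (fun y => gauge K.set y - ((supportFn K.set w)⁻¹ • innerSL ℝ (w : E n)) y) (ξ : E n) := by
    refine Eventually.of_forall fun y => ?_
    have e : gauge K.set (ξ : E n) - ((supportFn K.set w)⁻¹ • innerSL ℝ (w : E n)) (ξ : E n) = 0 := by
      have := mem_radialGaussImage.1 hw
      rw [radialFn_eq_inv_gauge K (sphere_ne_zero ξ),
        inv_mul_eq_iff_eq_mul₀ (K.gauge_pos (sphere_ne_zero ξ)).ne', real_inner_comm] at this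
      simp only [smul_apply, innerSL_apply_apply, smul_eq_mul, this]
      field_simp
      ring
    beta_reduce
    rw [e]
    simp only [smul_apply, innerSL_apply_apply, smul_eq_mul, sub_nonneg]
    rw [inv_mul_le_iff₀ hh, mul_comm]
    exact inner_le_gauge_mul_supportFn K w y
  exact sub_eq_zero.1 (hmin.hasFDerivAt_eq_zero hD)

/-- Every unit normal is a positive multiple of the gradient of the gauge, and only one such
multiple has norm one. -/
theorem exists_radialGaussImage_eq_singleton {K : Body n} {ξ : Sph n}
    (hd : DifferentiableAt ℝ (gauge K.set) ξ) :
    ∃ v : Sph n, radialGaussImage K.set ξ = {v} := by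
  obtain ⟨v, hv⟩ := radialGaussImage_nonempty K ξ
  refine ⟨v, Set.eq_singleton_iff_unique_mem.2 ⟨hv, fun w hw => ?_⟩⟩
  have h := (fderiv_gauge_of_mem_radialGaussImage hd hw).symm.trans
    (fderiv_gauge_of_mem_radialGaussImage hd hv)
  have hw0 := supportFn_pos K w
  have hv0 := supportFn_pos K v
  have h2 : (supportFn K.set w)⁻¹ • (w : E n) = (supportFn K.set v)⁻¹ • (v : E n) := by
    refine ext_inner_right ℝ fun y => ?_
    simpa [real_inner_smul_left] using congrArg (fun L => L y) h
  have h3 := congrArg norm h2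
  rw [norm_smul, norm_smul, norm_sphere, norm_sphere, mul_one, mul_one,
    Real.norm_of_nonneg (by positivity), Real.norm_of_nonneg (by positivity)] at h3
  rw [h3] at h2
  exact Subtype.ext (smul_right_injective _ (inv_pos.2 hv0).ne' h2)

/-- The spherical measure of `s` is a multiple of the volume of the truncated cone `(0, 1) • s`. -/
theorem toSphere_eq_zero_of_cone_subset {s : Set (Sph n)} (hs : MeasurableSet s) {N : Set (E n)}
    (hN : volume N = 0) (h : ∀ ξ ∈ s, ∀ t : ℝ, 0 < t → t • (ξ : E n) ∈ N) :
    (volume : Measure (E n)).toSphere s = 0 := by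
  rw [Measure.toSphere_apply' _ hs]
  refine mul_eq_zero_of_right _ (measure_mono_null ?_ hN)
  rintro _ ⟨t, ht, _, ⟨ξ, hξ, rfl⟩, rfl⟩
  exact h ξ hξ t ht.1

/-- Rademacher's theorem for the gauge; by homogeneity its points of non-differentiability form a
cone, so the null set descends to the sphere. -/
theorem toSphere_ae_exists_singleton (K : Body n) :
    ∀ᵐ ξ ∂(volume : Measure (E n)).toSphere, ∃ v : Sph n, radialGaussImage K.set ξ = {v} := by
  obtain ⟨C, hC⟩ := K.1.convex.lipschitz_gauge K.mem_nhds_zero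
  have hae : ∀ᵐ x ∂(volume : Measure (E n)), DifferentiableAt ℝ (gauge K.set) x :=
    hC.ae_differentiableAt
  have h0 : (volume : Measure (E n)).toSphere
      {ξ : Sph n | ¬DifferentiableAt ℝ (gauge K.set) ξ} = 0 := by
    refine toSphere_eq_zero_of_cone_subset ?_ (ae_iff.1 hae) fun ξ hξ t ht hdiff => hξ ?_
    · exact measurable_subtype_coe (measurableSet_of_differentiableAt ℝ (gauge K.set)).compl
    · have e : gauge K.set = fun x => t⁻¹ * gauge K.set (t • x) := by
        ext x
        rw [gauge_smul_of_nonneg ht.le, smul_eq_mul, inv_mul_cancel_left₀ ht.ne']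
      rw [e]
      exact (hdiff.comp (ξ : E n) (by fun_prop : DifferentiableAt ℝ (fun x : E n => t • x) ξ)).const_mul _
  filter_upwards [compl_mem_ae_iff.2 h0] with ξ hξ
  exact exists_radialGaussImage_eq_singleton (not_not.1 hξ)

/-! ### Push-forwards of signed measures with a density -/

section Pushforward

variable {X Y : Type*} [MeasurableSpace X] [MeasurableSpace Y] {lam : Measure X} {f : X → ℝ}
  {a : X → Y} {μ : SignedMeasure Y}

theorem isFiniteMeasure_withDensity_ofReal_of_integrable (hf : Integrable f lam) :
    IsFiniteMeasure (lam.withDensity fun x => ENNReal.ofReal (f x)) :=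
  isFiniteMeasure_withDensity_ofReal hf.2

theorem vectorMeasure_integral_toSignedMeasure (ν : Measure X) [IsFiniteMeasure ν] (g : X → ℝ) :
    ∫ᵛ x, g x ∂•ν.toSignedMeasure = ∫ x, g x ∂ν := by
  -- Commutativity of real multiplication makes the two orders of the pairing agree.
  have : ContinuousLinearMap.lsmul ℝ ℝ = (ContinuousLinearMap.lsmul ℝ ℝ (E := ℝ)).flip := by
    ext; simp
  rw [this, VectorMeasure.integral_toSignedMeasure]

/-- Splitting `f` into positive and negative parts writes `μ` as a difference of push-forwards of
finite measures, for which the change of variables is classical. -/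
theorem integral_eq_integral_comp_mul (hf : Integrable f lam) (ha : Measurable a)
    (hμ : ∀ ω, MeasurableSet ω → μ ω = ∫ x in a ⁻¹' ω, f x ∂lam) {g : Y → ℝ}
    (hg : StronglyMeasurable g) {C : ℝ} (hC : ∀ y, ‖g y‖ ≤ C) :
    ∫ᵛ y, g y ∂•μ = ∫ x, g (a x) * f x ∂lam := by
  have := isFiniteMeasure_withDensity_ofReal_of_integrable hf
  have := isFiniteMeasure_withDensity_ofReal_of_integrable hf.fun_neg
  set p := lam.withDensity fun x => ENNReal.ofReal (f x) with hp
  set m := lam.withDensity fun x => ENNReal.ofReal (-f x) with hm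
  have hdec : μ = (p.map a).toSignedMeasure - (m.map a).toSignedMeasure := by
    ext ω hω
    have h := congrArg (fun ν : SignedMeasure X => ν (a ⁻¹' ω))
      (withDensityᵥ_eq_withDensity_pos_part_sub_withDensity_neg_part hf)
    simp only [withDensityᵥ_apply hf (ha hω), sub_apply] at h
    rw [hμ ω hω, h, sub_apply, Measure.toSignedMeasure_apply_measurable hω,
      Measure.toSignedMeasure_apply_measurable hω, map_measureReal_apply ha hω,
      map_measureReal_apply ha hω, Measure.toSignedMeasure_apply_measurable (ha hω),
      Measure.toSignedMeasure_apply_measurable (ha hω)]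
  have hint : ∀ ν : Measure Y, IsFiniteMeasure ν → Integrable g ν := fun ν _ =>
    Integrable.of_bound hg.aestronglyMeasurable C (Eventually.of_forall hC)
  have hga : StronglyMeasurable fun x => g (a x) := hg.comp_measurable ha
  have hgf : ∀ {F : X → ℝ}, Integrable F lam → Integrable (fun x => g (a x) * F x) lam := fun hF =>
    hF.bdd_mul hga.aestronglyMeasurable (Eventually.of_forall fun x => hC (a x))
  have hpart : ∀ {F : X → ℝ}, Integrable F lam →
      ∫ y, g y ∂((lam.withDensity fun x => ENNReal.ofReal (F x)).map a) =
        ∫ x, g (a x) * max (F x) 0 ∂lam := by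
    intro F hF
    rw [integral_map ha.aemeasurable hg.aestronglyMeasurable,
      integral_withDensity_eq_integral_toReal_smul₀ hF.1.aemeasurable.ennreal_ofReal
        (Eventually.of_forall fun x => ENNReal.ofReal_lt_top)]
    simp_rw [ENNReal.toReal_ofReal', smul_eq_mul, mul_comm]
  rw [hdec, VectorMeasure.integral_sub_vectorMeasure, vectorMeasure_integral_toSignedMeasure,
    vectorMeasure_integral_toSignedMeasure, hpart hf, hpart hf.fun_neg,
    ← integral_sub (hgf hf.pos_part) (hgf hf.neg_part)]
  · refine integral_congr_ae (Eventually.of_forall fun x => ?_)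
    simp only [← mul_sub]
    congr 1
    rcases le_total 0 (f x) with h | h
    · rw [max_eq_left h, max_eq_right (by linarith), sub_zero]
    · rw [max_eq_right h, max_eq_left (by linarith)]; ring
  · simpa [VectorMeasure.Integrable] using hint _ inferInstance
  · simpa [VectorMeasure.Integrable] using hint _ inferInstance

theorem exists_measure_of_pos (hlam : lam ≠ 0) (hf : Integrable f lam) (hpos : ∀ x, 0 < f x)
    (ha : Measurable a) (hμ : ∀ ω, MeasurableSet ω → μ ω = ∫ x in a ⁻¹' ω, f x ∂lam) :
    ∃ m : Measure Y, ∃ _ : IsFiniteMeasure m, m ≠ 0 ∧ μ = m.toSignedMeasure := by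
  have := isFiniteMeasure_withDensity_ofReal_of_integrable hf
  refine ⟨(lam.withDensity fun x => ENNReal.ofReal (f x)).map a, inferInstance, ?_, ?_⟩
  · rw [Ne, Measure.map_eq_zero_iff ha.aemeasurable,
      withDensity_eq_zero_iff hf.1.aemeasurable.ennreal_ofReal]
    intro h
    refine hlam (ae_eq_bot.1 (eventually_false_iff_eq_bot.1 ?_))
    filter_upwards [h] with x hx
    exact (ENNReal.ofReal_pos.2 (hpos x)).ne' hx
  · ext ω hω
    rw [hμ ω hω, Measure.toSignedMeasure_apply_measurable hω, map_measureReal_apply ha hω,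
      measureReal_def, withDensity_apply _ (ha hω),
      integral_eq_lintegral_of_nonneg_ae (Eventually.of_forall fun x => (hpos x).le)
        hf.1.restrict]

end Pushforward

/-! ### Image measures -/

/-- The closed graph property makes `radialGaussMap` continuous on a measurable set of full measure.
The version `a` avoids its arbitrary values elsewhere. -/
theorem exists_measurable_radialGaussMap {lam : Measure (Sph n)} (K : Body n)
    (h : ∀ᵐ ξ ∂lam, ∃ v : Sph n, radialGaussImage K.set ξ = {v}) :
    ∃ a : Sph n → Sph n, Measurable a ∧ (∀ᵐ ξ ∂lam, radialGaussImage K.set ξ = {a ξ}) ∧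
      radialGaussMap K.set =ᵐ[lam] a := by
  obtain ⟨D, hD, hDm, hD0⟩ : ∃ D : Set (Sph n),
      D ⊆ {ξ | ∃ v : Sph n, radialGaussImage K.set ξ = {v}} ∧ MeasurableSet D ∧ lam Dᶜ = 0 := by
    obtain ⟨D, h1, h2, h3⟩ := exists_measurable_superset_of_null (ae_iff.1 h)
    exact ⟨Dᶜ, compl_subset_comm.1 h1, h2.compl, by rwa [compl_compl]⟩
  have hc : ContinuousOn (radialGaussMap K.set) D := fun ξ hξ =>
    tendsto_of_mem_radialGaussImage (Ks := fun _ => K) tendsto_const_nhds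
      (tendsto_id.mono_left nhdsWithin_le_nhds)
      (by
        filter_upwards [self_mem_nhdsWithin] with ζ hζ
        rw [id, radialGaussImage_eq_singleton (hD hζ)]
        rfl)
      (radialGaussImage_eq_singleton (hD hξ))
  have hr : lam.restrict D = lam := Measure.restrict_eq_self_of_ae_mem (mem_ae_iff.2 hD0)
  have hm : AEMeasurable (radialGaussMap K.set) lam := hr ▸ hc.aemeasurable hDm
  refine ⟨hm.mk _, hm.measurable_mk, ?_, hm.ae_eq_mk⟩
  filter_upwards [h, hm.ae_eq_mk] with ξ h1 h2
  rw [← h2]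
  exact radialGaussImage_eq_singleton h1

section ImageMeasure

variable {lam : Measure (Sph n)} {K : Body n} {f : Sph n → ℝ} {μ : SignedMeasure (Sph n)}
  {a : Sph n → Sph n}

theorem reverseRadialGaussImage_ae_eq (ha : ∀ᵐ ξ ∂lam, radialGaussImage K.set ξ = {a ξ})
    (ω : Set (Sph n)) : reverseRadialGaussImage K.set ω =ᵐ[lam] a ⁻¹' ω := by
  refine eventuallyEq_set.2 ?_
  filter_upwards [ha] with ξ hξ
  rw [mem_reverseRadialGaussImage, hξ]
  simp

theorem IsImageMeasure.apply_eq_preimage (h : IsImageMeasure lam K f μ)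
    (ha : ∀ᵐ ξ ∂lam, radialGaussImage K.set ξ = {a ξ}) (ω : Set (Sph n)) (hω : MeasurableSet ω) :
    μ ω = ∫ ξ in a ⁻¹' ω, f ξ ∂lam := by
  rw [h.apply_eq ω hω, setIntegral_congr_set (reverseRadialGaussImage_ae_eq ha ω)]

theorem IsImageMeasure.neg (h : IsImageMeasure lam K f μ) :
    IsImageMeasure lam K (fun ξ => -f ξ) (-μ) where
  integrable := h.integrable.neg
  nullMeasurableSet := h.nullMeasurableSet
  apply_eq ω hω := by rw [neg_apply, h.apply_eq ω hω, integral_neg]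

theorem isImageMeasure_imageMeasure (hs : ∀ᵐ ξ ∂lam, ∃ v : Sph n, radialGaussImage K.set ξ = {v})
    (hf : Integrable f lam) : IsImageMeasure lam K f (imageMeasure lam K f) := by
  obtain ⟨a, ha, has, -⟩ := exists_measurable_radialGaussMap K hs
  have hex : ∃ μ : SignedMeasure (Sph n), IsImageMeasure lam K f μ := by
    -- The reverse radial Gauss image of `ω` agrees with `a ⁻¹' ω` up to a null set, so the
    -- push-forward of `f dλ` is the required measure.
    refine ⟨(lam.withDensityᵥ f).map a, hf, fun ω hω => ?_, fun ω hω => ?_⟩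
    · exact (ha hω).nullMeasurableSet.congr (reverseRadialGaussImage_ae_eq has ω).symm
    · rw [VectorMeasure.map_apply _ ha hω, withDensityᵥ_apply hf (ha hω),
        setIntegral_congr_set (reverseRadialGaussImage_ae_eq has ω)]
  rw [imageMeasure, dif_pos hex]
  exact hex.choose_spec

theorem IsImageMeasure.integral_eq
    (hs : ∀ᵐ ξ ∂lam, ∃ v : Sph n, radialGaussImage K.set ξ = {v})
    (h : IsImageMeasure lam K f μ) (g : C(Sph n, ℝ)) :
    ∫ᵛ u, g u ∂•μ = ∫ ξ, g (radialGaussMap K.set ξ) * f ξ ∂lam := by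
  obtain ⟨a, ha, has, hae⟩ := exists_measurable_radialGaussMap K hs
  rw [integral_eq_integral_comp_mul h.integrable ha (h.apply_eq_preimage has)
    g.continuous.stronglyMeasurable g.norm_coe_le_norm]
  refine integral_congr_ae ?_
  filter_upwards [hae] with ξ hξ
  rw [hξ]

theorem IsImageMeasure.isNonzeroFiniteMeasure (hlam : lam ≠ 0)
    (hs : ∀ᵐ ξ ∂lam, ∃ v : Sph n, radialGaussImage K.set ξ = {v})
    (h : IsImageMeasure lam K f μ) (hpos : ∀ ξ, 0 < f ξ) : IsNonzeroFiniteMeasure μ := by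
  obtain ⟨a, ha, has, -⟩ := exists_measurable_radialGaussMap K hs
  exact exists_measure_of_pos hlam h.integrable hpos ha (h.apply_eq_preimage has)

/-- From `a ≤ h_K(v) = ρ_K(ξ) ξ · v ≤ b ξ · v`, every normal satisfies `ξ · v ≥ a / b`; moving `ξ`
to `u` by less than `a / b` keeps the product positive. -/
theorem exists_inner_radialGaussImage_pos (K : Body n) (u : Sph n) :
    ∃ U : Set (Sph n), IsOpen U ∧ u ∈ U ∧
      ∀ ξ ∈ U, ∀ v ∈ radialGaussImage K.set ξ, 0 < inner ℝ (u : E n) (v : E n) := by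
  have : Nonempty (Sph n) := ⟨u⟩
  obtain ⟨a, b, ha, hab⟩ := exists_supportFn_bounds K
  have hb : 0 < b := ha.trans_le ((hab u).1.trans (hab u).2)
  refine ⟨Metric.ball u (a / b), Metric.isOpen_ball, Metric.mem_ball_self (by positivity),
    fun ξ hξ v hv => ?_⟩
  have h1 : a / b ≤ inner ℝ (ξ : E n) (v : E n) := by
    rw [div_le_iff₀ hb, mul_comm]
    refine (hab v).1.trans ?_
    rw [← mem_radialGaussImage.1 hv]
    exact mul_le_mul_of_nonneg_right ((radialFn_le_supportFn K ξ).trans (hab ξ).2)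
      (inner_pos_of_mem_radialGaussImage hv).le
  have h2 : inner ℝ (ξ : E n) (v : E n) - inner ℝ (u : E n) (v : E n) < a / b := by
    rw [← inner_sub_left]
    refine (real_inner_le_norm _ _).trans_lt ?_
    rw [norm_sphere v, mul_one, ← dist_eq_norm, ← Subtype.dist_eq]
    exact hξ
  linarith

theorem IsImageMeasure.notConcentratedOnHemisphere
    (hs : ∀ᵐ ξ ∂lam, ∃ v : Sph n, radialGaussImage K.set ξ = {v})
    (h : IsImageMeasure lam K f μ) (hpos : ∀ ξ, 0 < f ξ)
    (hU : ∀ U : Set (Sph n), IsOpen U → U.Nonempty → 0 < lam U) :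
    NotConcentratedOnHemisphere μ := by
  intro u
  let g : C(Sph n, ℝ) := ⟨fun v => max (inner ℝ (u : E n) (v : E n)) 0, by fun_prop⟩
  have hg : ∀ v, 0 ≤ g v := fun v => le_max_right _ _
  obtain ⟨a, ha, -, hae⟩ := exists_measurable_radialGaussMap K hs
  have hint : Integrable (fun ξ => g (radialGaussMap K.set ξ) * f ξ) lam := by
    refine h.integrable.bdd_mul (c := ‖g‖) ?_ (Eventually.of_forall fun _ => g.norm_coe_le_norm _)
    exact (g.continuous.measurable.comp_aemeasurable ⟨a, ha, hae⟩).aestronglyMeasurable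
  obtain ⟨U, hUo, huU, hUp⟩ := exists_inner_radialGaussImage_pos K u
  change 0 < ∫ᵛ v, g v ∂•μ
  rw [h.integral_eq hs g, integral_pos_iff_support_of_nonneg
    (fun ξ => mul_nonneg (hg _) (hpos ξ).le) hint]
  refine (hU U hUo ⟨u, huU⟩).trans_le (measure_mono_ae ?_)
  filter_upwards [hs] with ξ hξ hξU
  have hm : radialGaussMap K.set ξ ∈ radialGaussImage K.set ξ := by
    rw [radialGaussImage_eq_singleton hξ]; rfl
  exact (mul_pos (lt_max_of_lt_left (hUp ξ hξU _ hm)) (hpos ξ)).ne'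

end ImageMeasure

/-! ### Absolute continuity with respect to the surface area measure -/

theorem quasiMeasurePreserving_removeNth {m : ℕ} (i : Fin (m + 1)) :
    Measure.QuasiMeasurePreserving (fun x : E (m + 1) => i.removeNth x.ofLp) volume volume :=
  (Measure.quasiMeasurePreserving_snd.comp
    (volume_preserving_piFinSuccAbove (fun _ => ℝ) i).quasiMeasurePreserving).comp
    (PiLp.volume_preserving_ofLp (Fin (m + 1))).quasiMeasurePreserving

theorem lipschitzWith_removeNth {m : ℕ} (i : Fin (m + 1)) :
    LipschitzWith 1 fun x : E (m + 1) => i.removeNth x.ofLp := by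
  refine LipschitzWith.of_dist_le_mul fun x y => ?_
  rw [NNReal.coe_one, one_mul, dist_pi_le_iff dist_nonneg]
  intro j
  rw [dist_eq_norm, dist_eq_norm]
  exact PiLp.norm_apply_le (x - y) (i.succAbove j)

/-- Dropping a coordinate is Lipschitz into `ℝᵐ` with the sup norm, where `ℋᵐ` is Lebesgue measure;
the cylinder over a null set is null. -/
theorem volume_cylinder_eq_zero {m : ℕ} {B : Set (E (m + 1))}
    (hB : (Measure.hausdorffMeasure m : Measure (E (m + 1))) B = 0) (i : Fin (m + 1)) :
    volume ((fun x : E (m + 1) => i.removeNth x.ofLp) ⁻¹'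
      ((fun x : E (m + 1) => i.removeNth x.ofLp) '' B)) = 0 := by
  refine (quasiMeasurePreserving_removeNth i).preimage_null ?_
  rw [← hausdorffMeasure_pi_real, Fintype.card_fin]
  refine le_antisymm (((lipschitzWith_removeNth i).hausdorffMeasure_image_le
    (Nat.cast_nonneg m) B).trans ?_) zero_le
  rw [hB, mul_zero]

/-- Polar coordinates over a coordinate hyperplane: `z` is sent to `zᵢ u`, where `u` is the unit
vector that has the same coordinates as `z` except for the `i`-th one, which has sign `σ`. -/
noncomputable def coneChart {m : ℕ} (i : Fin m) (σ : ℝ) (z : E m) : E m :=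
  z i • (z + (σ * √(1 - ‖z‖ ^ 2 + z i ^ 2) - z i) • EuclideanSpace.single i (1 : ℝ))

theorem differentiableOn_coneChart {m : ℕ} (i : Fin m) (σ : ℝ) :
    DifferentiableOn ℝ (coneChart i σ) {z | 0 < 1 - ‖z‖ ^ 2 + z i ^ 2} := by
  intro z hz
  have h1 : DifferentiableAt ℝ (fun z : E m => z i) z := by fun_prop
  have h2 : DifferentiableAt ℝ (fun z : E m => 1 - ‖z‖ ^ 2 + z i ^ 2) z :=
    ((differentiableAt_const _).sub (differentiableAt_id.norm_sq ℝ)).add (h1.pow 2)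
  have h3 := h2.sqrt (ne_of_gt hz)
  exact (h1.smul (differentiableAt_id.add
    (((h3.const_mul σ).sub h1).smul_const _))).differentiableWithinAt

/-- Here `z` is `u` with its `i`-th coordinate replaced by `t`; since `‖u‖ = 1`, the other
coordinates recover `u i` up to the sign `σ`. -/
theorem smul_eq_coneChart {m : ℕ} {u : E m} (hu : ‖u‖ = 1) {i : Fin m} {σ : ℝ}
    (hσ : σ * |u i| = u i) (t : ℝ) {z : E m}
    (hz : z = u + (t - u i) • EuclideanSpace.single i (1 : ℝ)) :
    1 - ‖z‖ ^ 2 + z i ^ 2 = u i ^ 2 ∧ coneChart i σ z = t • u := by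
  have hzi : z i = t := by simp [hz]
  have hn : 1 - ‖z‖ ^ 2 + z i ^ 2 = u i ^ 2 := by
    rw [hzi, hz, norm_add_sq_real, hu, norm_smul, PiLp.norm_single, inner_smul_right,
      EuclideanSpace.inner_single_right, Real.norm_eq_abs, mul_pow, sq_abs]
    simp
    ring
  refine ⟨hn, ?_⟩
  rw [coneChart, hn, Real.sqrt_sq_eq_abs, hσ, hzi, hz, add_assoc, ← add_smul]
  simp

/-- Any unit vector has a nonzero coordinate, so the cone over the part of `B` on the sphere is
covered by images of null cylinders under finitely many differentiable charts, and these preserve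
null sets in equal dimension. -/
theorem toSphere_eq_zero_of_hausdorffMeasure_eq_zero {m : ℕ} {B : Set (E (m + 1))}
    (hB : (Measure.hausdorffMeasure m : Measure (E (m + 1))) B = 0) :
    (volume : Measure (E (m + 1))).toSphere (Subtype.val ⁻¹' B) = 0 := by
  wlog hBm : MeasurableSet B generalizing B
  · refine measure_mono_null (preimage_mono (subset_toMeasurable
      (Measure.hausdorffMeasure m : Measure (E (m + 1))) B)) (this ?_ (measurableSet_toMeasurable _ _))
    rw [measure_toMeasurable, hB]
  set Z : Fin (m + 1) → Set (E (m + 1)) := fun i =>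
    (fun x : E (m + 1) => i.removeNth x.ofLp) ⁻¹'
      ((fun x : E (m + 1) => i.removeNth x.ofLp) '' B) ∩ {z | 0 < 1 - ‖z‖ ^ 2 + z i ^ 2} with hZ
  have hZ0 : ∀ i σ, volume (coneChart i σ '' Z i) = 0 := fun i σ =>
    addHaar_image_eq_zero_of_differentiableOn_of_addHaar_eq_zero _
      ((differentiableOn_coneChart i σ).mono inter_subset_right)
      (measure_mono_null inter_subset_left (volume_cylinder_eq_zero hB i))
  refine toSphere_eq_zero_of_cone_subset (measurable_subtype_coe hBm)
    (N := ⋃ i, (coneChart i 1 '' Z i ∪ coneChart i (-1) '' Z i))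
    (measure_iUnion_null fun i => measure_union_null (hZ0 i 1) (hZ0 i (-1))) fun u hu t _ => ?_
  obtain ⟨i, hi⟩ : ∃ i, (u : E (m + 1)) i ≠ 0 := by
    by_contra! h
    exact sphere_ne_zero u (by ext i; simpa using h i)
  set z : E (m + 1) := u + (t - (u : E (m + 1)) i) • EuclideanSpace.single i (1 : ℝ) with hz
  have hzZ : 1 - ‖z‖ ^ 2 + z i ^ 2 = (u : E (m + 1)) i ^ 2 → z ∈ Z i := fun h => by
    refine ⟨⟨u, hu, ?_⟩, ?_⟩
    · ext j
      simp [hz, Fin.removeNth_apply, Fin.succAbove_ne]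
    · rw [mem_ofPred_eq, h]
      positivity
  refine mem_iUnion.2 ⟨i, ?_⟩
  rcases le_total 0 ((u : E (m + 1)) i) with h | h
  · obtain ⟨h1, h2⟩ := smul_eq_coneChart (norm_sphere u) (σ := 1) (by rw [one_mul, abs_of_nonneg h])
      t hz
    exact Or.inl ⟨z, hzZ h1, h2⟩
  · obtain ⟨h1, h2⟩ := smul_eq_coneChart (norm_sphere u) (σ := -1)
      (by rw [neg_one_mul, abs_of_nonpos h, neg_neg]) t hz
    exact Or.inr ⟨z, hzZ h1, h2⟩

theorem lipschitzOnWith_normalize {r : ℝ} (hr : 0 < r) :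
    LipschitzOnWith (Real.toNNReal (2 / r)) (fun x : E n => ‖x‖⁻¹ • x) {x | r ≤ ‖x‖} := by
  refine LipschitzOnWith.of_dist_le_mul fun x hx y hy => ?_
  rw [mem_ofPred_eq] at hx hy
  have hx0 : 0 < ‖x‖ := hr.trans_le hx
  have hy0 : 0 < ‖y‖ := hr.trans_le hy
  rw [Real.coe_toNNReal _ (by positivity), dist_eq_norm, dist_eq_norm]
  -- Each summand has norm at most `‖x - y‖ / ‖x‖`, whence the factor 2.
  have e : ‖x‖⁻¹ • x - ‖y‖⁻¹ • y = ‖x‖⁻¹ • (x - y) + (‖x‖⁻¹ - ‖y‖⁻¹) • y := by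
    rw [smul_sub, sub_smul]; abel
  have h1 : ‖(‖x‖⁻¹ - ‖y‖⁻¹) • y‖ ≤ ‖x‖⁻¹ * ‖x - y‖ := by
    have : ‖x‖⁻¹ - ‖y‖⁻¹ = ‖x‖⁻¹ * ((‖y‖ - ‖x‖) * ‖y‖⁻¹) := by field_simp
    rw [this, norm_smul, norm_mul, norm_mul, norm_inv, norm_inv, norm_norm, norm_norm, mul_assoc,
      mul_assoc, inv_mul_cancel₀ hy0.ne', mul_one, norm_sub_rev x y]
    gcongr
    exact abs_norm_sub_norm_le y x
  rw [e]
  calc _ ≤ ‖x‖⁻¹ * ‖x - y‖ + ‖x‖⁻¹ * ‖x - y‖ := by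
        refine (norm_add_le _ _).trans (add_le_add ?_ h1)
        rw [norm_smul, norm_inv, norm_norm]
    _ = 2 * ‖x‖⁻¹ * ‖x - y‖ := by ring
    _ ≤ _ := by
      rw [div_eq_mul_inv]
      gcongr

/-- Boundary points stay outside a ball about the origin, so normalization, which inverts the radial
map, is Lipschitz on them and preserves `ℋ^{n-1}`-null sets. -/
theorem toSphere_reverseRadialGaussImage_eq_zero (hn : 1 ≤ n) {K : Body n} {ω : Set (Sph n)}
    (h : surfaceArea K ω = 0) :
    (volume : Measure (E n)).toSphere (reverseRadialGaussImage K.set ω) = 0 := by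
  obtain ⟨m, rfl⟩ : ∃ m, n = m + 1 := ⟨n - 1, by omega⟩
  have h0 : (Measure.hausdorffMeasure m : Measure (E (m + 1))) (reverseGaussImage K.set ω) = 0 := by
    rw [surfaceArea, Measure.euclideanHausdorffMeasure_def, Measure.smul_apply, smul_eq_zero] at h
    exact h.resolve_left (Measure.addHaarScalarFactor_volume_hausdorffMeasure_ne_zero _)
  obtain ⟨r, hr, hball⟩ := Metric.mem_nhds_iff.1 (interior_mem_nhds.2 K.mem_nhds_zero)
  have hsub : reverseGaussImage K.set ω ⊆ {x | r ≤ ‖x‖} := fun x hx => by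
    by_contra hlt
    exact hx.1.2 (hball (by simpa using hlt))
  refine measure_mono_null (t := Subtype.val ⁻¹' ((fun x : E (m + 1) => ‖x‖⁻¹ • x) ''
    reverseGaussImage K.set ω)) (fun ξ hξ => ⟨radialMap K.set ξ, hξ, ?_⟩)
    (toSphere_eq_zero_of_hausdorffMeasure_eq_zero ?_)
  · have := radialFn_pos K ξ
    simp only [radialMap, norm_smul, norm_sphere, mul_one, Real.norm_of_nonneg this.le, smul_smul,
      inv_mul_cancel₀ this.ne', one_smul]
  · refine le_antisymm ((((lipschitzOnWith_normalize hr).mono hsub).hausdorffMeasure_image_le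
      (Nat.cast_nonneg m)).trans ?_) zero_le
    rw [h0, mul_zero]

theorem IsImageMeasure.absContSurfaceArea (hn : 1 ≤ n) {lam : Measure (Sph n)} {K : Body n}
    {f : Sph n → ℝ} {μ : SignedMeasure (Sph n)} (h : IsImageMeasure lam K f μ)
    (hlam : lam ≪ (volume : Measure (E n)).toSphere) : AbsContSurfaceArea μ K := by
  intro ω hω h0
  rw [h.apply_eq ω hω]
  exact setIntegral_measure_zero _ (hlam (toSphere_reverseRadialGaussImage_eq_zero hn h0))

/-! ### Jointly continuous densities -/

section Density

variable {q : Body n → Sph n → Sph n → ℝ} {lam : Measure (Sph n)}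

theorem aestronglyMeasurable_comp_radialGaussMap {K : Body n}
    (hs : ∀ᵐ ξ ∂lam, ∃ v : Sph n, radialGaussImage K.set ξ = {v}) {F : Sph n × Sph n → ℝ}
    (hF : Continuous F) : AEStronglyMeasurable (fun ξ => F (ξ, radialGaussMap K.set ξ)) lam := by
  obtain ⟨a, ha, -, hae⟩ := exists_measurable_radialGaussMap K hs
  exact (hF.measurable.comp_aemeasurable
    (aemeasurable_id.prodMk ⟨a, ha, hae⟩)).aestronglyMeasurable

theorem integrable_comp_radialGaussMap [IsFiniteMeasure lam] {K : Body n}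
    (hs : ∀ᵐ ξ ∂lam, ∃ v : Sph n, radialGaussImage K.set ξ = {v}) {F : Sph n × Sph n → ℝ}
    (hF : Continuous F) : Integrable (fun ξ => F (ξ, radialGaussMap K.set ξ)) lam := by
  obtain ⟨C, hC⟩ := (isCompact_range hF).isBounded.exists_norm_le
  exact Integrable.of_bound (aestronglyMeasurable_comp_radialGaussMap hs hF) C
    (Eventually.of_forall fun ξ => hC _ (mem_range_self _))

theorem weaklyConverges_imageMeasure [IsFiniteMeasure lam]
    (hs : ∀ K : Body n, ∀ᵐ ξ ∂lam, ∃ v : Sph n, radialGaussImage K.set ξ = {v})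
    (hq : Continuous fun p : Body n × Sph n × Sph n => q p.1 p.2.1 p.2.2)
    {μ : Body n → SignedMeasure (Sph n)}
    (hμ : ∀ K, IsImageMeasure lam K (fun ξ => q K ξ (radialGaussMap K.set ξ)) (μ K))
    {Ks : ℕ → Body n} {K : Body n} (hK : Tendsto Ks atTop (𝓝 K)) :
    WeaklyConverges (fun i => μ (Ks i)) (μ K) := by
  intro g
  simp_rw [fun K => (hμ K).integral_eq (hs K) g]
  -- A convergent sequence together with its limit is compact, so the kernel is bounded uniformly in
  -- `i`; this gives the dominating constant.
  obtain ⟨C, hC⟩ := (((hK.isCompact_insert_range).prod isCompact_univ).image_of_continuousOn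
    hq.continuousOn).isBounded.exists_norm_le
  refine tendsto_integral_of_dominated_convergence (fun _ => ‖g‖ * C) (fun i => ?_)
    (integrable_const _) (fun i => Eventually.of_forall fun ξ => ?_) ?_
  · exact aestronglyMeasurable_comp_radialGaussMap (hs (Ks i))
      (F := fun p => g p.2 * q (Ks i) p.1 p.2)
      ((g.continuous.comp continuous_snd).mul (hq.comp (by fun_prop :
        Continuous fun p : Sph n × Sph n => (Ks i, p.1, p.2))))
  · rw [norm_mul]
    refine mul_le_mul (g.norm_coe_le_norm _) (hC _ ?_) (norm_nonneg _) (norm_nonneg _)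
    exact ⟨(Ks i, ξ, radialGaussMap (Ks i).set ξ),
      ⟨mem_insert_of_mem _ (mem_range_self i), mem_univ _⟩, rfl⟩
  -- The countably many exceptional sets of the `Ks i` and of `K` are discarded together.
  · filter_upwards [ae_all_iff.2 fun i => hs (Ks i), hs K] with ξ h1 h2
    have hα : Tendsto (fun i => radialGaussMap (Ks i).set ξ) atTop
        (𝓝 (radialGaussMap K.set ξ)) :=
      tendsto_of_mem_radialGaussImage hK (tendsto_const_nhds (x := ξ))
        (Eventually.of_forall fun i => by rw [radialGaussImage_eq_singleton (h1 i)]; rfl)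
        (radialGaussImage_eq_singleton h2)
    exact ((g.continuous.tendsto _).comp hα).mul ((hq.tendsto (K, ξ, _)).comp
      (hK.prodMk_nhds (tendsto_const_nhds.prodMk_nhds hα)))

end Density

/-! ### The Musielak-Orlicz-Gauss image measures -/

theorem partialT_ne_zero {Ψ : Sph n → ℝ → ℝ} (hΨ : ClassCI Ψ ∨ ClassCd Ψ) (v : Sph n) {t : ℝ}
    (ht : 0 < t) : partialT Ψ v t ≠ 0 :=
  hΨ.elim (fun h => (h.pos v t ht).ne') fun h => (h.neg v t ht).ne

theorem classC_of_classCI_or_classCd {Ψ : Sph n → ℝ → ℝ} (hΨ : ClassCI Ψ ∨ ClassCd Ψ) : ClassC Ψ :=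
  hΨ.elim (fun h => h.toClassC) fun h => h.toClassC

theorem ClassC.continuous_mul_partialT {G : Sph n → ℝ → ℝ} (hG : ClassC G) {X : Type*}
    [TopologicalSpace X] {ζ : X → Sph n} {t : X → ℝ} (hζ : Continuous ζ) (ht : Continuous t)
    (hpos : ∀ x, 0 < t x) : Continuous fun x => t x * partialT G (ζ x) (t x) :=
  ht.mul (hG.continuousOn_partialT.comp_continuous (hζ.prodMk ht)
    fun x => ⟨mem_univ _, hpos x⟩)

/-- The common form of the two densities, with `τ` in the place of `h_K` or `ρ_{K*}`. -/
noncomputable def densityKernel (G Ψ : Sph n → ℝ → ℝ) (τ : Body n → Sph n → ℝ) (K : Body n)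
    (ξ v : Sph n) : ℝ :=
  (radialFn K.set ξ * partialT G ξ (radialFn K.set ξ)) / (τ K v * partialT Ψ v (τ K v))

theorem continuous_densityKernel {G Ψ : Sph n → ℝ → ℝ} (hG : ClassC G)
    (hΨ : ClassCI Ψ ∨ ClassCd Ψ) {τ : Body n → Sph n → ℝ}
    (hτ : Continuous fun p : Body n × Sph n => τ p.1 p.2) (hτ0 : ∀ K v, 0 < τ K v) :
    Continuous fun p : Body n × Sph n × Sph n => densityKernel G Ψ τ p.1 p.2.1 p.2.2 := by
  refine (hG.continuous_mul_partialT (by fun_prop) ?_ fun p => radialFn_pos _ _).div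
    ((classC_of_classCI_or_classCd hΨ).continuous_mul_partialT (by fun_prop) ?_ fun p => hτ0 _ _)
    fun p => mul_ne_zero (hτ0 _ _).ne' (partialT_ne_zero hΨ _ (hτ0 _ _))
  · exact continuous_radialFn.comp (continuous_fst.prodMk continuous_snd.fst)
  · exact hτ.comp (continuous_fst.prodMk continuous_snd.snd)

theorem densityKernel_pos {G Ψ : Sph n → ℝ → ℝ}
    (h : (ClassCI G ∧ ClassCI Ψ) ∨ (ClassCd G ∧ ClassCd Ψ)) {τ : Body n → Sph n → ℝ}
    (hτ0 : ∀ K v, 0 < τ K v) (K : Body n) (ξ v : Sph n) : 0 < densityKernel G Ψ τ K ξ v := by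
  have hρ := radialFn_pos K ξ
  have hv := hτ0 K v
  rcases h with ⟨hG, hΨ⟩ | ⟨hG, hΨ⟩
  · exact div_pos (mul_pos hρ (hG.pos _ _ hρ)) (mul_pos hv (hΨ.pos _ _ hv))
  · exact div_pos_of_neg_of_neg (mul_neg_of_pos_of_neg hρ (hG.neg _ _ hρ))
      (mul_neg_of_pos_of_neg hv (hΨ.neg _ _ hv))

theorem densityKernel_neg {G Ψ : Sph n → ℝ → ℝ}
    (h : (ClassCI G ∧ ClassCd Ψ) ∨ (ClassCd G ∧ ClassCI Ψ)) {τ : Body n → Sph n → ℝ}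
    (hτ0 : ∀ K v, 0 < τ K v) (K : Body n) (ξ v : Sph n) : densityKernel G Ψ τ K ξ v < 0 := by
  have hρ := radialFn_pos K ξ
  have hv := hτ0 K v
  rcases h with ⟨hG, hΨ⟩ | ⟨hG, hΨ⟩
  · exact div_neg_of_pos_of_neg (mul_pos hρ (hG.pos _ _ hρ))
      (mul_neg_of_pos_of_neg hv (hΨ.neg _ _ hv))
  · exact div_neg_of_neg_of_pos (mul_neg_of_pos_of_neg hρ (hG.neg _ _ hρ))
      (mul_pos hv (hΨ.pos _ _ hv))

theorem ClassM.ae_exists_singleton {lam : Measure (Sph n)} (hlam : ClassM lam) (K : Body n) :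
    ∀ᵐ ξ ∂lam, ∃ v : Sph n, radialGaussImage K.set ξ = {v} :=
  hlam.absolutelyContinuous (toSphere_ae_exists_singleton K)

theorem isImageMeasure_densityKernel {G Ψ : Sph n → ℝ → ℝ} {lam : Measure (Sph n)}
    (hG : ClassC G) (hΨ : ClassCI Ψ ∨ ClassCd Ψ) (hlam : ClassM lam) {τ : Body n → Sph n → ℝ}
    (hτ : Continuous fun p : Body n × Sph n => τ p.1 p.2) (hτ0 : ∀ K v, 0 < τ K v) (K : Body n) :
    IsImageMeasure lam K (fun ξ => densityKernel G Ψ τ K ξ (radialGaussMap K.set ξ))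
      (imageMeasure lam K fun ξ => densityKernel G Ψ τ K ξ (radialGaussMap K.set ξ)) := by
  have := hlam.finite
  refine isImageMeasure_imageMeasure (hlam.ae_exists_singleton K) ?_
  exact integrable_comp_radialGaussMap (hlam.ae_exists_singleton K)
    (F := fun p => densityKernel G Ψ τ K p.1 p.2)
    ((continuous_densityKernel hG hΨ hτ hτ0).comp (by fun_prop :
      Continuous fun p : Sph n × Sph n => (K, p.1, p.2)))

theorem continuous_radialFn_polarSet :
    Continuous fun p : Body n × Sph n => radialFn (polarSet p.1.set) p.2 := by
  simp_rw [radialFn_polarSet]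
  exact continuous_supportFn.inv₀ fun p => (supportFn_pos p.1 p.2).ne'

theorem radialFn_polarSet_pos (K : Body n) (v : Sph n) : 0 < radialFn (polarSet K.set) v := by
  rw [radialFn_polarSet]
  exact inv_pos.2 (supportFn_pos K v)

end MusielakOrliczGauss

open MusielakOrliczGauss in
theorem mainTheorem5 (n : ℕ) (hn : 2 ≤ n) (G Ψ : Sph n → ℝ → ℝ) (lam : Measure (Sph n))
    (hG : ClassC G) (hΨ : ClassCI Ψ ∨ ClassCd Ψ) (hlam : ClassM lam) :
    -- both signed measures are well defined by their integral formulas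
    (∀ K : Body n,
      (∀ᵐ ξ ∂lam, ∃ v : Sph n, radialGaussImage K.set ξ = {v}) ∧
      IsImageMeasure lam K (density G Ψ K) (mogMeasure G Ψ lam K) ∧
      IsImageMeasure lam K (polarDensity G Ψ K) (polarMogMeasure G Ψ lam K)) ∧
    -- i) weak continuity
    (∀ (Ks : ℕ → Body n) (K : Body n), Tendsto Ks atTop (𝓝 K) →
      WeaklyConverges (fun i => polarMogMeasure G Ψ lam (Ks i)) (polarMogMeasure G Ψ lam K) ∧
      WeaklyConverges (fun i => mogMeasure G Ψ lam (Ks i)) (mogMeasure G Ψ lam K)) ∧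
    -- ii) absolute continuity
    (∀ K : Body n,
      AbsContSurfaceArea (polarMogMeasure G Ψ lam K) K ∧
      AbsContSurfaceArea (mogMeasure G Ψ lam K) K) ∧
    -- iii) equal monotonicity
    ((ClassCI G ∧ ClassCI Ψ) ∨ (ClassCd G ∧ ClassCd Ψ) → ∀ K : Body n,
      (IsNonzeroFiniteMeasure (mogMeasure G Ψ lam K) ∧
        IsNonzeroFiniteMeasure (polarMogMeasure G Ψ lam K)) ∧
      ((∀ U : Set (Sph n), IsOpen U → U.Nonempty → 0 < lam U) →
        NotConcentratedOnHemisphere (mogMeasure G Ψ lam K) ∧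
        NotConcentratedOnHemisphere (polarMogMeasure G Ψ lam K))) ∧
    -- iii) opposite monotonicity
    ((ClassCI G ∧ ClassCd Ψ) ∨ (ClassCd G ∧ ClassCI Ψ) → ∀ K : Body n,
      (IsNonzeroFiniteMeasure (-mogMeasure G Ψ lam K) ∧
        IsNonzeroFiniteMeasure (-polarMogMeasure G Ψ lam K)) ∧
      ((∀ U : Set (Sph n), IsOpen U → U.Nonempty → 0 < lam U) →
        NotConcentratedOnHemisphere (-mogMeasure G Ψ lam K) ∧
        NotConcentratedOnHemisphere (-polarMogMeasure G Ψ lam K))) := by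
  have := hlam.finite
  have hs := hlam.ae_exists_singleton
  have hc : Continuous fun p : Body n × Sph n => supportFn p.1.set p.2 := continuous_supportFn
  have hp := continuous_radialFn_polarSet (n := n)
  -- Both densities are definitionally `densityKernel`, with `τ` equal to `h_K` here and to `ρ_{K*}`
  -- for `h2`.
  have h1 : ∀ K, IsImageMeasure lam K (density G Ψ K) (mogMeasure G Ψ lam K) :=
    isImageMeasure_densityKernel hG hΨ hlam hc supportFn_pos
  have h2 : ∀ K, IsImageMeasure lam K (polarDensity G Ψ K) (polarMogMeasure G Ψ lam K) :=
    isImageMeasure_densityKernel hG hΨ hlam hp radialFn_polarSet_pos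
  refine ⟨fun K => ⟨hs K, h1 K, h2 K⟩, fun Ks K hK => ⟨?_, ?_⟩, fun K => ⟨?_, ?_⟩,
    fun h K => ?_, fun h K => ?_⟩
  · exact weaklyConverges_imageMeasure hs
      (continuous_densityKernel hG hΨ hp radialFn_polarSet_pos) h2 hK
  · exact weaklyConverges_imageMeasure hs
      (continuous_densityKernel hG hΨ hc supportFn_pos) h1 hK
  · exact (h2 K).absContSurfaceArea (by omega) hlam.absolutelyContinuous
  · exact (h1 K).absContSurfaceArea (by omega) hlam.absolutelyContinuous
  · have p1 : ∀ ξ, 0 < density G Ψ K ξ := fun ξ => densityKernel_pos h supportFn_pos K ξ _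
    have p2 : ∀ ξ, 0 < polarDensity G Ψ K ξ := fun ξ =>
      densityKernel_pos h radialFn_polarSet_pos K ξ _
    exact ⟨⟨(h1 K).isNonzeroFiniteMeasure hlam.ne_zero (hs K) p1,
      (h2 K).isNonzeroFiniteMeasure hlam.ne_zero (hs K) p2⟩, fun hU =>
      ⟨(h1 K).notConcentratedOnHemisphere (hs K) p1 hU,
        (h2 K).notConcentratedOnHemisphere (hs K) p2 hU⟩⟩
  · have p1 : ∀ ξ, 0 < -density G Ψ K ξ := fun ξ =>
      neg_pos.2 (densityKernel_neg h supportFn_pos K ξ _)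
    have p2 : ∀ ξ, 0 < -polarDensity G Ψ K ξ := fun ξ =>
      neg_pos.2 (densityKernel_neg h radialFn_polarSet_pos K ξ _)
    exact ⟨⟨(h1 K).neg.isNonzeroFiniteMeasure hlam.ne_zero (hs K) p1,
      (h2 K).neg.isNonzeroFiniteMeasure hlam.ne_zero (hs K) p2⟩, fun hU =>
      ⟨(h1 K).neg.notConcentratedOnHemisphere (hs K) p1 hU,
        (h2 K).neg.notConcentratedOnHemisphere (hs K) p2 hU⟩⟩
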